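/- Let $\Bbbk$ be an algebraically closed field, let $A$ be a finite local Gorenstein $\Bbbk$-algebra (that is, finite-dimensional over $\Bbbk$, with one-dimensional socle), let $V$ be a finite-dimensional $\Bbbk$-vector space, and let $S_A := A\otimes_{\Bbbk}\operatorname{Sym} V^*$ with the standard grading, in which $A$ has degree $0$ and $V^*$ has degree $1$. Let $\mathfrak n\subset S_A$ be the ideal generated by $V^*$, and for an ideal $K\subset S_A$ write $K^{\mathrm{sat}} := (K:\mathfrak n^\infty)=\bigcup_m (K:\mathfrak n^m)$. Fix a positive integer $r$ and two degrees $j>i\geq r$. Suppose $I\subset S_A$ is a homogeneous ideal such that both $(S_A/I)_i$ and $(S_A/I)_j$ are flat (hence free) $A$-modules of rank $r$, and let $J$ be the ideal generated by the homogeneous elements of $I$ of degree at most $i$. Then: (1) $(S_A/I)_k$ is flat (hence free) of rank $r$ for all $i<k<j$, and $I$ has no minimal generators in degrees $i+1,i+2,\dots,j$ (that is, no minimal set of homogeneous generators of $I$ contains an element of one of these degrees); (2) $(S_A/J)_k=(S_A/J^{\mathrm{sat}})_k$, that is $J_k=(J^{\mathrm{sat}})_k$, and both are flat (hence free) of rank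 $r$, for all $k\geq i$; (3) $(S_A/J^{\mathrm{sat}})_k$ is flat (hence free) of rank $r$ for all $k\geq r-1$. -/

import Mathlib

open scoped TensorProduct

namespace RelGotzmann

noncomputable section

/-- The socle of a local ring: the annihilator of its maximal ideal. -/
def socle (A : Type*) [CommRing A] [IsLocalRing A] : Ideal A :=
  (⊥ : Ideal A).colon (IsLocalRing.maximalIdeal A : Set A)

/-- A finite local algebra over an algebraically closed field `𝕜` (so that its residue field is
`𝕜`) is Gorenstein if its socle is one-dimensional. -/
def IsGorenstein (𝕜 A : Type*) [Field 𝕜] [CommRing A] [Algebra 𝕜 A] [IsLocalRing A]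
    [FiniteDimensional 𝕜 A] : Prop :=
  Module.finrank 𝕜 (socle A) = 1

/-- The `A`-algebra `A ⊗ Sym V^*`. -/
abbrev RelSym (𝕜 A V : Type*) [Field 𝕜] [CommRing A] [Algebra 𝕜 A] [AddCommGroup V]
    [Module 𝕜 V] : Type _ :=
  A ⊗[𝕜] SymmetricAlgebra 𝕜 (Module.Dual 𝕜 V)

/-- The degree `d` part `A ⊗ S^d V^*` of `A ⊗ Sym V^*`, for the standard grading: `S^d V^*` is
spanned by the products of `d` linear forms, and `A` has degree zero. -/
def grading (𝕜 A V : Type*) [Field 𝕜] [CommRing A] [Algebra 𝕜 A] [AddCommGroup V]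
    [Module 𝕜 V] (d : ℕ) : Submodule A (RelSym 𝕜 A V) :=
  Submodule.baseChange A (LinearMap.range (SymmetricAlgebra.ι 𝕜 (Module.Dual 𝕜 V)) ^ d)

section Graded

/-! In this section `S` is an `A`-algebra and `𝒮 d` is its part of degree `d`. -/

variable {A S : Type*} [CommRing A] [CommRing S] [Algebra A S] (𝒮 : ℕ → Submodule A S)

/-- An ideal is homogeneous if it is generated by homogeneous elements. -/
def IsHomogeneousIdeal (I : Ideal S) : Prop :=
  Ideal.span {f : S | f ∈ I ∧ ∃ d, f ∈ 𝒮 d} = I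

/-- The degree `k` part `I_k` of an ideal. -/
def degreePart (I : Ideal S) (k : ℕ) : Submodule A S :=
  I.restrictScalars A ⊓ 𝒮 k

/-- The degree `k` part `(S/I)_k = S_k / I_k` of the quotient by a homogeneous ideal. -/
abbrev QuotientPart (I : Ideal S) (k : ℕ) : Type _ :=
  (𝒮 k) ⧸ (degreePart 𝒮 I k).submoduleOf (𝒮 k)

/-- The ideal generated by the elements of `I` that are homogeneous of degree at most `i`. -/
def truncation (I : Ideal S) (i : ℕ) : Ideal S :=
  Ideal.span {f : S | f ∈ I ∧ ∃ d ≤ i, f ∈ 𝒮 d}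

/-- The ideal `𝔫` generated by the elements of degree one. -/
def linearIdeal : Ideal S := Ideal.span (𝒮 1 : Set S)

/-- The saturation `(I : 𝔫^∞)`, the (increasing) union of the ideals `(I : 𝔫^m)`. -/
def saturation (I : Ideal S) : Ideal S :=
  ⨆ m : ℕ, Submodule.colon I ((linearIdeal 𝒮 ^ m : Ideal S) : Set S)

/-- `s` is a set of homogeneous generators of `I` that is minimal for inclusion. -/
def IsMinimalGeneratingSet (I : Ideal S) (s : Set S) : Prop :=
  (∀ f ∈ s, ∃ d, f ∈ 𝒮 d) ∧ Ideal.span s = I ∧ ∀ t, t ⊂ s → Ideal.span t ≠ I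

/-- `I` has a minimal generator of degree `k`. -/
def HasMinimalGenerator (I : Ideal S) (k : ℕ) : Prop :=
  ∃ s, IsMinimalGeneratingSet 𝒮 I s ∧ ∃ f ∈ s, f ∈ 𝒮 k

end Graded

/-- The `A`-module `M` is free of rank `r`. -/
def IsFreeOfRank (A M : Type*) [CommRing A] [AddCommGroup M] [Module A M] (r : ℕ) : Prop :=
  Module.Free A M ∧ Module.rank A M = r

end

end RelGotzmann

namespace RelGotzmann

/-! Write `S` for the graded ring and `M = (S/I)_i`. Since `r ≤ i` and the residue field is
infinite, a special case of Green's theorem on the closed fibre, lifted by Nakayama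
(`exists_linear_form`), gives a linear form `l` for which multiplication by `l` maps `(S/I)_{i-1}`
onto `M`; it then remains onto in all higher degrees. Hence `l^(j-i) : M → (S/I)_j` is a surjection
of free modules of equal rank, so it is bijective, and every `l^d` with `d ≤ j - i` is injective on
`M`.

Setting `l = 1` turns `M` into an `S`-module with an equivariant map `φ : S → M`
(`exists_dehomogenization`), which is the quotient map in degree `i` and satisfies `φ (l^d f) = φ
f`. In degree `k` the kernel of `φ` is the saturation of `J`, and for `k ≥ i` it is `J` itself; for
`i ≤ k ≤ j` it is also `I`. So every quotient in question is `M` as soon as `S_k` maps onto `M`.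
This is clear for `k ≥ i`. For `k ≥ r - 1` it follows from `map_eq_top_of_le_succ`: modulo the
maximal ideal, the images of the `S_k` grow strictly until they fill an `r`-dimensional space. -/

theorem span_coe_pow {R A T : Type*} [CommRing R] [CommRing A] [CommRing T] [Algebra R A]
    [Algebra R T] [Algebra A T] [IsScalarTower R A T] (P : Submodule R T) (d : ℕ) :
    Submodule.span A ((P ^ d : Submodule R T) : Set T) = Submodule.span A (P : Set T) ^ d := by
  conv_lhs => rw [← Submodule.span_eq P, Submodule.span_pow, Submodule.span_span_of_tower]
  rw [Submodule.span_pow]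

/-! ### Gradings generated in degree one -/

section PowerGrading

universe u w

variable {A : Type w} {S : Type u} [CommRing A] [CommRing S] [Algebra A S]
  {𝒮 : ℕ → Submodule A S}

theorem gradedMonoid_of_pow_eq (h : ∀ d, 𝒮 d = 𝒮 1 ^ d) : SetLike.GradedMonoid 𝒮 where
  one_mem := by
    rw [h, pow_zero]
    exact Submodule.one_le.mp le_rfl
  mul_mem i j x y hx hy := by
    rw [h] at hx hy ⊢
    rw [pow_add]
    exact Submodule.mul_mem_mul hx hy

open scoped DirectSum in
/-- An algebra with `𝒮 d = (𝒮 1) ^ d` is graded if linear maps on `𝒮 1` extend to algebra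
homomorphisms, and algebra endomorphisms are determined by their restriction to `𝒮 1`. -/
theorem nonempty_gradedAlgebra_of_pow_eq (h : ∀ d, 𝒮 d = 𝒮 1 ^ d)
    (hlift : ∀ (C : Type u) [CommRing C] [Algebra A C] (f : 𝒮 1 →ₗ[A] C),
      ∃ F : S →ₐ[A] C, ∀ x : 𝒮 1, F x = f x)
    (hext : ∀ G : S →ₐ[A] S, (∀ x ∈ 𝒮 1, G x = x) → G = AlgHom.id A S) :
    Nonempty (GradedAlgebra 𝒮) := by
  have := gradedMonoid_of_pow_eq h
  -- Placing `𝒮 1` in degree one of the direct sum extends to an algebra map, which is the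
  -- decomposition map.
  obtain ⟨F, hF⟩ := hlift (⨁ d, 𝒮 d) (DirectSum.lof A ℕ (fun d => 𝒮 d) 1)
  refine ⟨GradedAlgebra.ofAlgHom _ F ?_ ?_⟩
  · refine hext _ fun x hx => ?_
    have := hF ⟨x, hx⟩
    dsimp only at this
    rw [AlgHom.comp_apply, this, DirectSum.lof_eq_of, DirectSum.coeAlgHom_of]
  · rintro i ⟨x, hx⟩
    have hx' := hx
    rw [h] at hx'
    dsimp only
    induction hx' using Submodule.pow_induction_on_left' with
    | algebraMap r =>
      rw [AlgHom.commutes, DirectSum.algebraMap_apply]; rfl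
    | add x y i h1 h2 ih1 ih2 =>
      rw [← h] at h1 h2
      rw [map_add, ih1 h1, ih2 h2, ← map_add]
      rfl
    | mem_mul m hm i x hx' ih =>
      rw [← h] at hx'
      have := hF ⟨m, hm⟩
      dsimp only at this
      rw [map_mul, ih hx', this, DirectSum.lof_eq_of, DirectSum.of_mul_of]
      exact DirectSum.of_eq_of_gradedMonoid_eq (Sigma.subtype_ext (add_comm _ _) rfl)

end PowerGrading

/-! ### The standard grading and universal property of `A ⊗ Sym V^*` -/

section RelSym

variable {𝕜 A V : Type*} [Field 𝕜] [CommRing A] [Algebra 𝕜 A] [AddCommGroup V] [Module 𝕜 V]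

theorem baseChange_pow_submodule {R : Type*} [CommRing R] [Algebra 𝕜 R] (p : Submodule 𝕜 R)
    (d : ℕ) : (p ^ d).baseChange A = p.baseChange A ^ d := by
  have h : ∀ q : Submodule 𝕜 R, Submodule.map (TensorProduct.mk 𝕜 A R 1) q =
      Submodule.map (Algebra.TensorProduct.includeRight (A := A) (R := 𝕜) (B := R)).toLinearMap q :=
    fun _ => rfl
  rw [Submodule.baseChange_eq_span, Submodule.baseChange_eq_span, h, h, Submodule.map_pow,
    span_coe_pow]

theorem grading_eq_pow (d : ℕ) : grading 𝕜 A V d = grading 𝕜 A V 1 ^ d := by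
  rw [grading, grading, pow_one, baseChange_pow_submodule]

theorem grading_one_fg [FiniteDimensional 𝕜 V] : (grading 𝕜 A V 1).FG := by
  rw [grading, pow_one]
  have : (LinearMap.range (SymmetricAlgebra.ι 𝕜 (Module.Dual 𝕜 V))).FG :=
    (Module.Finite.iff_fg).mp inferInstance
  obtain ⟨s, hs⟩ := this
  rw [← hs, Submodule.baseChange_span]
  exact Submodule.fg_span (s.finite_toSet.image _)

theorem one_tmul_ι_mem_grading (v : Module.Dual 𝕜 V) :
    (1 : A) ⊗ₜ[𝕜] SymmetricAlgebra.ι 𝕜 (Module.Dual 𝕜 V) v ∈ grading 𝕜 A V 1 := by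
  rw [grading, pow_one]
  exact Submodule.tmul_mem_baseChange_of_mem _ (LinearMap.mem_range_self _ _)

theorem grading_one_eq_span : grading 𝕜 A V 1 = Submodule.span A (Set.range fun v =>
    (1 : A) ⊗ₜ[𝕜] SymmetricAlgebra.ι 𝕜 (Module.Dual 𝕜 V) v) := by
  rw [grading, pow_one, Submodule.baseChange_eq_span]
  congr 1
  ext x
  simp

theorem exists_algHom_extending {C : Type*} [CommRing C] [Algebra A C]
    (u : grading 𝕜 A V 1 →ₗ[A] C) :
    ∃ F : RelSym 𝕜 A V →ₐ[A] C, ∀ x : grading 𝕜 A V 1, F x = u x := by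
  let _ : Algebra 𝕜 C := Algebra.compHom C (algebraMap 𝕜 A)
  have : IsScalarTower 𝕜 A C := IsScalarTower.of_algebraMap_eq fun _ => rfl
  let w : Module.Dual 𝕜 V →ₗ[𝕜] C := u.restrictScalars 𝕜 ∘ₗ
    { toFun := fun v => ⟨_, one_tmul_ι_mem_grading v⟩
      map_add' := fun a b => Subtype.ext (by simp [TensorProduct.tmul_add])
      map_smul' := fun a b => Subtype.ext (by simp) }
  let F := AlgHom.liftEquiv 𝕜 A _ C (SymmetricAlgebra.lift w)
  refine ⟨F, ?_⟩
  have key : ∀ x (hx : x ∈ grading 𝕜 A V 1), F x = u ⟨x, hx⟩ := by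
    intro x hx
    have hx' := hx
    rw [grading_one_eq_span] at hx'
    induction hx' using Submodule.span_induction with
    | mem x h =>
      obtain ⟨v, rfl⟩ := h
      simp [F, w]
    | zero => rw [map_zero]; exact (map_zero u).symm
    | add x y h1 h2 ih1 ih2 =>
      rw [← grading_one_eq_span] at h1 h2
      rw [map_add, ih1 h1, ih2 h2, ← map_add]; rfl
    | smul a x h ih =>
      rw [← grading_one_eq_span] at h
      rw [map_smul, ih h, ← map_smul]; rfl
  exact fun x => key x x.2

theorem relSym_algHom_ext {C : Type*} [CommRing C] [Algebra A C] {F G : RelSym 𝕜 A V →ₐ[A] C}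
    (h : ∀ x ∈ grading 𝕜 A V 1, F x = G x) : F = G := by
  let _ : Algebra 𝕜 C := Algebra.compHom C (algebraMap 𝕜 A)
  have : IsScalarTower 𝕜 A C := IsScalarTower.of_algebraMap_eq fun _ => rfl
  refine Algebra.TensorProduct.ext (by ext) ?_
  apply SymmetricAlgebra.algHom_ext
  ext v
  exact h _ (one_tmul_ι_mem_grading v)

/-- The standard grading makes `A ⊗ Sym V^*` a graded algebra. -/
theorem nonempty_gradedAlgebra_grading : Nonempty (GradedAlgebra (grading 𝕜 A V)) :=
  nonempty_gradedAlgebra_of_pow_eq grading_eq_pow (fun _ _ _ => exists_algHom_extending)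
    fun _ hG => relSym_algHom_ext hG

end RelSym

/-! ### Green's restriction theorem in small dimension -/

section Green

/-- Surjectivity is an open condition on the pencil. For a section `σ` of `a` and `t = s⁻¹`, the
composite `(a + t • b) ∘ σ` is `s⁻¹ (s + b ∘ σ)`, invertible for `s` outside a finite spectrum. -/
theorem exists_ne_zero_add_smul_surjective {κ E F : Type*} [Field κ] [Infinite κ]
    [AddCommGroup E] [Module κ E] [AddCommGroup F] [Module κ F] [FiniteDimensional κ F]
    (a b : E →ₗ[κ] F) (ha : Function.Surjective a) :
    ∃ t : κ, t ≠ 0 ∧ Function.Surjective (a + t • b) := by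
  obtain ⟨σ, hσ⟩ := a.exists_rightInverse_of_surjective (LinearMap.range_eq_top.mpr ha)
  have hfin : (spectrum κ (-(b ∘ₗ σ) : Module.End κ F) ∪ {0}).Finite :=
    (Module.End.finite_spectrum _).union (Set.finite_singleton 0)
  obtain ⟨s, hs⟩ := hfin.exists_notMem
  simp only [Set.mem_union, Set.mem_singleton_iff, not_or] at hs
  obtain ⟨hs, hs0⟩ := hs
  rw [spectrum.notMem_iff, sub_neg_eq_add] at hs
  refine ⟨s⁻¹, inv_ne_zero hs0, fun y => ?_⟩
  obtain ⟨z, hz⟩ := ((Module.End.isUnit_iff _).mp hs).2 (s • y)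
  refine ⟨σ z, ?_⟩
  have h1 : a (σ z) = z := LinearMap.congr_fun hσ z
  have h2 : s • z + b (σ z) = s • y := by simpa using hz
  rw [LinearMap.add_apply, LinearMap.smul_apply, h1]
  calc z + s⁻¹ • b (σ z) = s⁻¹ • (s • z + b (σ z)) := by
        rw [smul_add, smul_smul, inv_mul_cancel₀ hs0, one_smul]
    _ = y := by rw [h2, smul_smul, inv_mul_cancel₀ hs0, one_smul]

variable {κ Q : Type*} [Field κ] [CommRing Q] [Algebra κ Q]

open Submodule in
/-- The linear forms `ℓ` for which multiplication by `ℓ` is onto `g L^{i+1}` span `L`,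
as soon as there is one. -/
theorem le_span_of_exists_surjective [Infinite κ] {L : Submodule κ Q} (hL : L.FG) (g : Q) (i : ℕ)
    {l : Q} (hl : l ∈ L) (h : span κ {g} * L ^ (i + 1) ≤ span κ {g * l} * L ^ i) :
    L ≤ span κ {l | l ∈ L ∧ span κ {g} * L ^ (i + 1) ≤ span κ {g * l} * L ^ i} := by
  intro x hx
  have hfg : (span κ {g} * L ^ (i + 1)).FG := (fg_span_singleton g).mul (hL.pow _)
  have : FiniteDimensional κ ↥(span κ {g} * L ^ (i + 1)) := Module.Finite.of_fg hfg
  have hmem : ∀ y ∈ L, ∀ f ∈ L ^ i, g * y * f ∈ span κ {g} * L ^ (i + 1) := by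
    intro y hy f hf
    rw [mul_assoc, pow_succ']
    exact mul_mem_mul (mem_span_singleton_self g) (mul_mem_mul hy hf)
  let m : ∀ y ∈ L, ↥(L ^ i) →ₗ[κ] ↥(span κ {g} * L ^ (i + 1)) := fun y hy =>
    (LinearMap.mulLeft κ (g * y)).restrict (hmem y hy)
  have hsurj : ∀ y (hy : y ∈ L), Function.Surjective (m y hy) ↔
      span κ {g} * L ^ (i + 1) ≤ span κ {g * y} * L ^ i := by
    intro y hy
    constructor
    · intro hs z hz
      obtain ⟨f, hf⟩ := hs ⟨z, hz⟩
      have : g * y * f = z := congrArg Subtype.val hf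
      rw [← this]
      exact mul_mem_mul (mem_span_singleton_self _) f.2
    · rintro hs ⟨z, hz⟩
      obtain ⟨f, hf, hfz⟩ := mem_span_singleton_mul.mp (hs hz)
      exact ⟨⟨f, hf⟩, Subtype.ext hfz⟩
  obtain ⟨t, ht0, ht⟩ := exists_ne_zero_add_smul_surjective (m l hl) (m x hx)
    ((hsurj l hl).mpr h)
  have hlx : l + t • x ∈ L := L.add_mem hl (L.smul_mem t hx)
  have heq : m l hl + t • m x hx = m (l + t • x) hlx := by
    refine LinearMap.ext fun f => Subtype.ext ?_
    simp [m, mul_add, add_mul]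
  rw [heq, hsurj _ hlx] at ht
  -- Both `l` and the perturbation `l + t • x` are good forms, and `t ≠ 0`, so `x` lies in their
  -- span.
  have hx' : x = t⁻¹ • ((l + t • x) - l) := by
    rw [add_sub_cancel_left, smul_smul, inv_mul_cancel₀ ht0, one_smul]
  rw [hx']
  exact smul_mem _ _ (sub_mem (subset_span ⟨hlx, ht⟩) (subset_span ⟨hl, h⟩))

open Submodule Module in
/-- A special case of Green's hyperplane restriction theorem: if `dim g L^{i+1} ≤ i + 1`, then
multiplication by a general linear form `ℓ` maps `g L^i` onto `g L^{i+1}`. -/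
theorem le_span_surjective_of_finrank_le [Infinite κ] {L : Submodule κ Q} (hL : L.FG) (i : ℕ) :
    ∀ g : Q, finrank κ ↥(span κ {g} * L ^ (i + 1)) ≤ i + 1 →
      L ≤ span κ {l | l ∈ L ∧ span κ {g} * L ^ (i + 1) ≤ span κ {g * l} * L ^ i} := by
  have hfin : ∀ (g : Q) (d : ℕ), FiniteDimensional κ ↥(span κ {g} * L ^ d) := fun g d =>
    Module.Finite.of_fg ((fg_span_singleton g).mul (hL.pow _))
  have hle : ∀ g, ∀ l ∈ L, ∀ d, span κ {g * l} * L ^ d ≤ span κ {g} * L ^ (d + 1) := by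
    intro g l hl d
    have : span κ {g * l} = span κ {g} * span κ {l} := by
      rw [span_mul_span, Set.singleton_mul_singleton]
    rw [this, mul_assoc, pow_succ']
    exact mul_le_mul_right (mul_le_mul_left (by simpa using hl) _) _
  induction i with
  | zero =>
    intro g hg
    by_cases hex : ∃ l ∈ L, g * l ≠ 0
    · obtain ⟨l, hl, hgl⟩ := hex
      refine le_span_of_exists_surjective hL g 0 hl ?_
      have := hfin g (0 + 1)
      refine (eq_of_le_of_finrank_le (hle g l hl 0) ?_).ge
      rw [pow_zero, mul_one, finrank_span_singleton hgl]
      exact hg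
    · push Not at hex
      refine fun x hx => subset_span ⟨hx, ?_⟩
      rw [zero_add, pow_one, mul_le]
      intro y hy z hz
      obtain ⟨c, rfl⟩ := mem_span_singleton.mp hy
      rw [smul_mul_assoc, hex z hz, smul_zero]
      exact zero_mem _
  | succ i ih =>
    intro g hg
    let n : Q → ℕ := fun l => finrank κ ↥(span κ {g * l} * L ^ (i + 1))
    have hbound : ∀ l ∈ L, n l ≤ i + 2 := fun l hl =>
      have := hfin g (i + 1 + 1)
      (finrank_mono (hle g l hl (i + 1))).trans hg
    -- A form of maximal rank plays the role of a general one.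
    obtain ⟨l, hl, hmax⟩ : ∃ l ∈ L, ∀ l' ∈ L, n l' ≤ n l := by
      have hbdd : BddAbove (n '' (L : Set Q)) := by
        refine ⟨i + 2, ?_⟩
        rintro _ ⟨l, hl, rfl⟩
        exact hbound l hl
      obtain ⟨l, hl, hl'⟩ := Nat.sSup_mem (Set.Nonempty.image n ⟨0, L.zero_mem⟩) hbdd
      exact ⟨l, hl, fun l' h' => hl' ▸ le_csSup hbdd ⟨l', h', rfl⟩⟩
    refine le_span_of_exists_surjective hL g (i + 1) hl ?_
    have := hfin g (i + 1 + 1)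
    by_contra hnot
    have hlt : n l < finrank κ ↥(span κ {g} * L ^ (i + 1 + 1)) :=
      finrank_lt_finrank_of_lt (lt_of_le_not_ge (hle g l hl (i + 1)) hnot)
    -- If `l` fails, its rank drops to at most `i + 1`, so induction applies to `g * l`.
    have hspan := ih (g * l) (by change n l ≤ i + 1; omega)
    apply hnot
    rw [pow_succ' L (i + 1), mul_le]
    intro y hy z hz
    obtain ⟨c, rfl⟩ := mem_span_singleton.mp hy
    rw [smul_mul_assoc]
    refine smul_mem _ c ?_
    induction hz using Submodule.mul_induction_on' with
    | add a _ b _ ha hb => rw [mul_add]; exact add_mem ha hb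
    | mem_mul_mem x hx f hf =>
      have hL' : L ≤ (span κ {g * l} * L ^ (i + 1)).comap
          (LinearMap.mulLeft κ g ∘ₗ LinearMap.mulRight κ f) := by
        refine hspan.trans (span_le.mpr ?_)
        rintro l' ⟨hl', hge⟩
        -- The left side lies in `g l l' L^i`, hence in the right side. Maximality of the rank of
        -- `l` forces equality, so `g l' f` lies in `g l L^(i+1)`; as such `l'` span `L`, the form
        -- `l` did not fail.
        have h1 : span κ {g * l} * L ^ (i + 1) ≤ span κ {g * l'} * L ^ (i + 1) := by
          refine hge.trans ?_
          rw [mul_right_comm]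
          exact hle (g * l') l hl i
        have := hfin (g * l') (i + 1)
        rw [SetLike.mem_coe, mem_comap, eq_of_le_of_finrank_le h1 (hmax l' hl')]
        have := mul_mem_mul (mem_span_singleton_self (R := κ) (g * l')) hf
        simpa [mul_assoc] using this
      simpa using hL' hx

open Submodule Module in
theorem exists_pow_succ_le_span_singleton_mul [Infinite κ] {L : Submodule κ Q} (hL : L.FG) (i : ℕ)
    (h : finrank κ ↥(L ^ (i + 1)) ≤ i + 1) :
    ∃ l ∈ L, L ^ (i + 1) ≤ span κ {l} * L ^ i := by
  have h1 : span κ {(1 : Q)} = 1 := one_eq_span.symm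
  have key := le_span_surjective_of_finrank_le hL i 1 (by rwa [h1, one_mul])
  simp only [h1, one_mul] at key
  obtain hne | ⟨l, hl, hl'⟩ := Set.eq_empty_or_nonempty
    {l | l ∈ L ∧ L ^ (i + 1) ≤ span κ {l} * L ^ i}
  · rw [hne, span_empty, le_bot_iff] at key
    exact ⟨0, zero_mem _, by simp [key]⟩
  · exact ⟨l, hl, hl'⟩

end Green

/-! ### Lifting the linear form from the closed fibre -/

section LinearForm

variable {A S : Type*} [CommRing A] [CommRing S] [Algebra A S] {𝒮 : ℕ → Submodule A S}

theorem mul_mem_of_pow_eq (h : ∀ d, 𝒮 d = 𝒮 1 ^ d) {a b c : ℕ} (hc : a + b = c) {x y : S}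
    (hx : x ∈ 𝒮 a) (hy : y ∈ 𝒮 b) : x * y ∈ 𝒮 c := by
  subst hc
  have := gradedMonoid_of_pow_eq h
  exact SetLike.mul_mem_graded hx hy

theorem pow_mem_of_pow_eq (h : ∀ d, 𝒮 d = 𝒮 1 ^ d) {x : S} (hx : x ∈ 𝒮 1) (d : ℕ) :
    x ^ d ∈ 𝒮 d := by
  rw [h]
  exact Submodule.pow_mem_pow _ hx d

theorem succ_eq_mul_of_pow_eq (h : ∀ d, 𝒮 d = 𝒮 1 ^ d) (d : ℕ) : 𝒮 (d + 1) = 𝒮 1 * 𝒮 d := by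
  rw [h (d + 1), pow_succ', ← h]

/-- The elements of `𝒮 k` are divisible by `l` modulo `I` for all `k > n`, if this holds for
`k = n + 1`. -/
theorem exists_sub_mul_mem (h : ∀ d, 𝒮 d = 𝒮 1 ^ d) {I : Ideal S} {l : S} {n : ℕ}
    (hsurj : ∀ f ∈ 𝒮 (n + 1), ∃ g ∈ 𝒮 n, f - l * g ∈ I) {k : ℕ} (hk : n ≤ k) :
    ∀ f ∈ 𝒮 (k + 1), ∃ g ∈ 𝒮 k, f - l * g ∈ I := by
  induction k, hk using Nat.le_induction with
  | base => exact hsurj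
  | succ k hk ih =>
    intro f hf
    rw [succ_eq_mul_of_pow_eq h] at hf
    induction hf using Submodule.mul_induction_on' with
    | mem_mul_mem x hx y hy =>
      obtain ⟨g, hg, hyg⟩ := ih y hy
      refine ⟨x * g, mul_mem_of_pow_eq h (add_comm 1 k) hx hg, ?_⟩
      have : x * y - l * (x * g) = x * (y - l * g) := by ring
      exact this ▸ I.mul_mem_left x hyg
    | add a _ b _ iha ihb =>
      obtain ⟨g, hg, hag⟩ := iha
      obtain ⟨g', hg', hbg⟩ := ihb
      refine ⟨g + g', add_mem hg hg', ?_⟩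
      have : a + b - l * (g + g') = (a - l * g) + (b - l * g') := by ring
      exact this ▸ I.add_mem hag hbg

theorem exists_sub_pow_mul_mem (h : ∀ d, 𝒮 d = 𝒮 1 ^ d) {I : Ideal S} {l : S} {n : ℕ}
    (hsurj : ∀ f ∈ 𝒮 (n + 1), ∃ g ∈ 𝒮 n, f - l * g ∈ I) {k : ℕ} (hk : n ≤ k) (d : ℕ) :
    ∀ f ∈ 𝒮 (k + d), ∃ g ∈ 𝒮 k, f - l ^ d * g ∈ I := by
  induction d with
  | zero => exact fun f hf => ⟨f, hf, by simp⟩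
  | succ d ih =>
    intro f hf
    obtain ⟨g, hg, hfg⟩ := exists_sub_mul_mem h hsurj (by omega : n ≤ k + d) f hf
    obtain ⟨g', hg', hgg⟩ := ih g hg
    refine ⟨g', hg', ?_⟩
    have : f - l ^ (d + 1) * g' = (f - l * g) + l * (g - l ^ d * g') := by ring
    exact this ▸ I.add_mem hfg (I.mul_mem_left l hgg)

open IsLocalRing in
-- Green's bound applies over the residue field, to the quotient by `I` and the maximal ideal;
-- Nakayama lifts the resulting surjectivity to `A`.
theorem exists_linear_form [IsLocalRing A] [Infinite (ResidueField A)] [GradedAlgebra 𝒮]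
    (h : ∀ d, 𝒮 d = 𝒮 1 ^ d) (hfg : (𝒮 1).FG) {I : Ideal S} (hI : I.IsHomogeneous 𝒮) (n : ℕ)
    (s : Finset S) (hcard : s.card ≤ n + 1)
    (hs : 𝒮 (n + 1) ≤ Submodule.span A (s : Set S) ⊔ I.restrictScalars A) :
    ∃ l ∈ 𝒮 1, ∀ f ∈ 𝒮 (n + 1), ∃ g ∈ 𝒮 n, f - l * g ∈ I := by
  classical
  let K : Ideal S := I ⊔ (maximalIdeal A).map (algebraMap A S)
  let _ : Algebra (ResidueField A) (S ⧸ K) :=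
    (Ideal.Quotient.lift (maximalIdeal A) ((Ideal.Quotient.mk K).comp (algebraMap A S))
      fun a ha => Ideal.Quotient.eq_zero_iff_mem.mpr
        (Ideal.mem_sup_right (Ideal.mem_map_of_mem _ ha))).toAlgebra
  have : IsScalarTower A (ResidueField A) (S ⧸ K) := IsScalarTower.of_algebraMap_eq fun _ => rfl
  have hres : Function.Surjective (algebraMap A (ResidueField A)) := residue_surjective
  let π : S →ₐ[A] S ⧸ K := Ideal.Quotient.mkₐ A K
  have hπ : ∀ x, π x = 0 ↔ x ∈ K := fun x => Ideal.Quotient.eq_zero_iff_mem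
  let P : Submodule A (S ⧸ K) := (𝒮 1).map π.toLinearMap
  let L : Submodule (ResidueField A) (S ⧸ K) := Submodule.span _ (P : Set (S ⧸ K))
  have hpow : ∀ d, L ^ d = Submodule.span (ResidueField A) ((𝒮 d).map π.toLinearMap : Set _) := by
    intro d
    rw [h d, Submodule.map_pow, span_coe_pow]
  have hmem : ∀ d x, x ∈ L ^ d ↔ ∃ f ∈ 𝒮 d, π f = x := by
    intro d x
    rw [hpow, ← Submodule.restrictScalars_mem A, Submodule.restrictScalars_span _ _ hres,
      Submodule.span_eq]
    rfl
  have hL : L.FG := by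
    obtain ⟨t, ht⟩ := hfg
    have hP : P = Submodule.span A (π '' t) := by
      rw [show P = (𝒮 1).map π.toLinearMap from rfl, ← ht, Submodule.map_span]; rfl
    rw [show L = Submodule.span _ (P : Set (S ⧸ K)) from rfl, hP, Submodule.span_span_of_tower]
    exact Submodule.fg_span (t.finite_toSet.image _)
  have hrank : Module.finrank (ResidueField A) ↥(L ^ (n + 1)) ≤ n + 1 := by
    have hle : L ^ (n + 1) ≤ Submodule.span _ ((s.image π : Finset (S ⧸ K)) : Set (S ⧸ K)) := by
      rw [hpow, Submodule.span_le]
      rintro _ ⟨f, hf, rfl⟩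
      obtain ⟨a, ha, b, hb, rfl⟩ := Submodule.mem_sup.mp (hs hf)
      have hb0 : π b = 0 := (hπ b).mpr (Ideal.mem_sup_left hb)
      have : π (a + b) ∈ Submodule.span A (π '' s) := by
        rw [map_add, hb0, add_zero]
        have := Submodule.mem_map_of_mem (f := π.toLinearMap) ha
        rwa [Submodule.map_span] at this
      rw [Finset.coe_image]
      exact Submodule.span_subset_span A (ResidueField A) _ this
    refine (Submodule.finrank_mono hle).trans ((finrank_span_finset_le_card _).trans ?_)
    exact Finset.card_image_le.trans hcard
  obtain ⟨l', hl', hle⟩ := exists_pow_succ_le_span_singleton_mul hL n hrank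
  obtain ⟨l, hl, rfl⟩ := (hmem 1 l').mp (by rwa [pow_one])
  refine ⟨l, hl, ?_⟩
  let N : Submodule A S := (𝒮 n).map (LinearMap.mulLeft A l) ⊔ I.restrictScalars A
  have hN : 𝒮 (n + 1) ≤ N := by
    refine Submodule.le_of_le_smul_of_le_jacobson_bot (I := maximalIdeal A) ?_
      (maximalIdeal_le_jacobson _) ?_
    · rw [h]; exact hfg.pow _
    intro f hf
    obtain ⟨y, hy, hfy⟩ := Submodule.mem_span_singleton_mul.mp (hle ((hmem _ _).mpr ⟨f, hf, rfl⟩))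
    obtain ⟨g, hg, rfl⟩ := (hmem _ _).mp hy
    have hK : f - l * g ∈ K := by
      rw [← hπ, map_sub, map_mul, hfy, sub_self]
    obtain ⟨a, ha, c, hc, hac⟩ := Submodule.mem_sup.mp hK
    have hfl : f - l * g ∈ 𝒮 (n + 1) :=
      sub_mem hf (mul_mem_of_pow_eq h (add_comm 1 n) hl hg)
    -- Projecting to degree `n + 1` keeps the first term in `I` and puts the second in `maximalIdeal
    -- A • 𝒮 (n + 1)`, as Nakayama requires.
    have hproj : f - l * g = GradedAlgebra.proj 𝒮 (n + 1) a + GradedAlgebra.proj 𝒮 (n + 1) c := by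
      rw [← map_add, hac, GradedAlgebra.proj_apply, DirectSum.decompose_of_mem_same _ hfl]
    have hc' : GradedAlgebra.proj 𝒮 (n + 1) c ∈ maximalIdeal A • 𝒮 (n + 1) := by
      have : c ∈ (maximalIdeal A • ⊤ : Submodule A S) := by
        rw [Ideal.smul_top_eq_map]; exact hc
      have := Submodule.mem_map_of_mem (f := GradedAlgebra.proj 𝒮 (n + 1)) this
      rw [Submodule.map_smul''] at this
      refine Submodule.smul_mono le_rfl ?_ this
      rintro _ ⟨x, -, rfl⟩
      exact SetLike.coe_mem _
    have hf' : f = (l * g + GradedAlgebra.proj 𝒮 (n + 1) a) + GradedAlgebra.proj 𝒮 (n + 1) c := by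
      rw [add_assoc, ← hproj]; ring
    rw [hf']
    exact Submodule.add_mem_sup (Submodule.add_mem_sup ⟨g, hg, rfl⟩ (hI (n + 1) ha)) hc'
  intro f hf
  obtain ⟨_, ⟨g, hg, rfl⟩, b, hb, rfl⟩ := Submodule.mem_sup.mp (hN hf)
  exact ⟨g, hg, by simpa using hb⟩

end LinearForm

/-! ### Graded pieces of the quotient and dehomogenization -/

section QuotientPart

universe u w

variable {A : Type w} {S : Type u} [CommRing A] [CommRing S] [Algebra A S]
  {𝒮 : ℕ → Submodule A S}

/-- The class in `(S/I)_k` of an element of degree `k`. -/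
def QuotientPart.mk (I : Ideal S) (k : ℕ) : 𝒮 k →ₗ[A] QuotientPart 𝒮 I k :=
  Submodule.mkQ _

theorem QuotientPart.mk_surjective (I : Ideal S) (k : ℕ) :
    Function.Surjective (QuotientPart.mk (𝒮 := 𝒮) I k) :=
  Submodule.mkQ_surjective _

theorem QuotientPart.mk_eq_zero {I : Ideal S} {k : ℕ} {x : 𝒮 k} :
    QuotientPart.mk I k x = 0 ↔ (x : S) ∈ I := by
  rw [QuotientPart.mk, Submodule.mkQ_apply, Submodule.Quotient.mk_eq_zero]
  simp [Submodule.submoduleOf, degreePart]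

theorem QuotientPart.mk_eq_mk {I : Ideal S} {k : ℕ} {x y : 𝒮 k} :
    QuotientPart.mk I k x = QuotientPart.mk I k y ↔ (x : S) - y ∈ I := by
  rw [← sub_eq_zero, ← map_sub, QuotientPart.mk_eq_zero]; rfl

/-- The multiplication map `(S/I)_k → (S/I)_{k'}` by `g`. -/
def mulQuot (I : Ideal S) {k k' : ℕ} (g : S) (hg : ∀ x ∈ 𝒮 k, g * x ∈ 𝒮 k') :
    QuotientPart 𝒮 I k →ₗ[A] QuotientPart 𝒮 I k' :=
  Submodule.mapQ _ _ ((LinearMap.mulLeft A g).restrict hg) <| by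
    rintro ⟨x, hx⟩ h
    have hxI : x ∈ I ∧ x ∈ 𝒮 k := h
    exact ⟨I.mul_mem_left g hxI.1, hg x hx⟩

theorem mulQuot_mk (I : Ideal S) {k k' : ℕ} (g : S) (hg : ∀ x ∈ 𝒮 k, g * x ∈ 𝒮 k') (x : 𝒮 k) :
    mulQuot I g hg (QuotientPart.mk I k x) = QuotientPart.mk I k' ⟨g * x, hg x x.2⟩ := rfl

open scoped IsMulCommutative in
-- The universal property needs a commutative target; the subalgebra generated by the commuting
-- operators is one.
theorem exists_algHom_end (hlift : ∀ (C : Type u) [CommRing C] [Algebra A C] (f : 𝒮 1 →ₗ[A] C),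
      ∃ F : S →ₐ[A] C, ∀ x : 𝒮 1, F x = f x) {M : Type u} [AddCommGroup M] [Module A M]
    (X : 𝒮 1 →ₗ[A] Module.End A M) (hX : ∀ x y, X x * X y = X y * X x) :
    ∃ Φ : S →ₐ[A] Module.End A M, ∀ x : 𝒮 1, Φ x = X x := by
  let C := Algebra.adjoin A (Set.range X)
  have : IsMulCommutative C := Algebra.isMulCommutative_adjoin A <| by
    rintro _ ⟨x, rfl⟩ _ ⟨y, rfl⟩
    exact hX x y
  obtain ⟨F, hF⟩ := hlift C (X.codRestrict C.toSubmodule fun x =>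
    Algebra.subset_adjoin (Set.mem_range_self x))
  exact ⟨C.val.comp F, fun x => congrArg Subtype.val (hF x)⟩

/-- If multiplication by `l` is onto in degree `n + 1` and bijective in degree `n + 2`, then
`l⁻¹ x` for `x ∈ 𝒮 1` are commuting endomorphisms of `(S/I)_{n + 1}`; they make it a quotient of
the dehomogenization of `S` at `l`. -/
theorem exists_dehomogenization (h : ∀ d, 𝒮 d = 𝒮 1 ^ d)
    (hlift : ∀ (C : Type u) [CommRing C] [Algebra A C] (f : 𝒮 1 →ₗ[A] C),
      ∃ F : S →ₐ[A] C, ∀ x : 𝒮 1, F x = f x)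
    {I : Ideal S} {l : S} (hl : l ∈ 𝒮 1) {n : ℕ}
    (hsurj : ∀ f ∈ 𝒮 (n + 1), ∃ g ∈ 𝒮 n, f - l * g ∈ I)
    (hinj : ∀ f ∈ 𝒮 (n + 1), l * f ∈ I → f ∈ I) :
    ∃ (Φ : S →ₐ[A] Module.End A (QuotientPart 𝒮 I (n + 1)))
      (φ : S →ₗ[A] QuotientPart 𝒮 I (n + 1)),
      (∀ a b, φ (a * b) = Φ a (φ b)) ∧ Φ l = 1 ∧
        ∀ f : 𝒮 (n + 1), φ f = QuotientPart.mk I (n + 1) f := by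
  have hmul : ∀ g ∈ 𝒮 1, ∀ x ∈ 𝒮 (n + 1), g * x ∈ 𝒮 (n + 2) := fun g hg x hx =>
    mul_mem_of_pow_eq h (by omega) hg hx
  have hbij : Function.Bijective (mulQuot I l (hmul l hl)) := by
    constructor
    · refine (injective_iff_map_eq_zero _).mpr fun m hm => ?_
      obtain ⟨f, rfl⟩ := QuotientPart.mk_surjective I _ m
      rw [mulQuot_mk, QuotientPart.mk_eq_zero] at hm
      exact QuotientPart.mk_eq_zero.mpr (hinj f f.2 hm)
    · intro m
      obtain ⟨f, rfl⟩ := QuotientPart.mk_surjective I _ m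
      obtain ⟨g, hg, hfg⟩ := exists_sub_mul_mem h hsurj (Nat.le_succ n) f f.2
      refine ⟨QuotientPart.mk I _ ⟨g, hg⟩, ?_⟩
      rw [mulQuot_mk, eq_comm, QuotientPart.mk_eq_mk]
      exact hfg
  let e := LinearEquiv.ofBijective _ hbij
  have he : ∀ m, e m = mulQuot I l (hmul l hl) m := fun _ => rfl
  let X : 𝒮 1 →ₗ[A] Module.End A (QuotientPart 𝒮 I (n + 1)) :=
    { toFun := fun x => e.symm.toLinearMap ∘ₗ mulQuot I x (hmul x x.2)
      map_add' := fun x y => by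
        refine LinearMap.ext fun m => e.injective ?_
        obtain ⟨f, rfl⟩ := QuotientPart.mk_surjective I _ m
        simp only [LinearMap.comp_apply, LinearEquiv.coe_coe, LinearEquiv.apply_symm_apply,
          LinearMap.add_apply, map_add, mulQuot_mk]
        rw [← map_add]
        exact congrArg _ (Subtype.ext (add_mul _ _ _))
      map_smul' := fun a x => by
        refine LinearMap.ext fun m => e.injective ?_
        obtain ⟨f, rfl⟩ := QuotientPart.mk_surjective I _ m
        simp only [LinearMap.comp_apply, LinearEquiv.coe_coe, LinearEquiv.apply_symm_apply,
          LinearMap.smul_apply, map_smul, mulQuot_mk, RingHom.id_apply]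
        rw [← map_smul]
        exact congrArg _ (Subtype.ext (smul_mul_assoc _ _ _)) }
  have heX : ∀ x m, e (X x m) = mulQuot I x (hmul x x.2) m := fun x m => e.apply_symm_apply _
  -- Dividing by `l` before multiplying by `x` computes `l⁻¹ x` without `e.symm`: the class of `l *
  -- g` goes to that of `x * g`.
  have hXmk : ∀ (x : 𝒮 1) (f : 𝒮 (n + 1)) (g : 𝒮 n), (f : S) - l * g ∈ I →
      X x (QuotientPart.mk I _ f) =
        QuotientPart.mk I _ ⟨x * g, mul_mem_of_pow_eq h (add_comm 1 n) x.2 g.2⟩ := by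
    intro x f g hfg
    apply e.injective
    rw [heX, he, mulQuot_mk, mulQuot_mk, QuotientPart.mk_eq_mk]
    have : (x : S) * f - l * (x * g) = x * (f - l * g) := by ring
    exact this ▸ I.mul_mem_left _ hfg
  have hcomm : ∀ x y, X x * X y = X y * X x := by
    intro x y
    refine LinearMap.ext fun m => ?_
    obtain ⟨f, rfl⟩ := QuotientPart.mk_surjective I _ m
    obtain ⟨g, hg, hfg⟩ := hsurj f f.2
    apply e.injective
    rw [Module.End.mul_apply, Module.End.mul_apply, hXmk y f ⟨g, hg⟩ hfg, hXmk x f ⟨g, hg⟩ hfg,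
      heX, heX, mulQuot_mk, mulQuot_mk]
    exact congrArg _ (Subtype.ext (mul_left_comm _ _ _))
  have hXl : X ⟨l, hl⟩ = 1 := LinearMap.ext fun m => e.injective (heX _ m)
  obtain ⟨Φ, hΦ⟩ := exists_algHom_end hlift X hcomm
  -- This is the image of `1`, homogenized by `l` to degree `n + 1`.
  let v := QuotientPart.mk I _ (⟨l ^ (n + 1), pow_mem_of_pow_eq h hl _⟩ : 𝒮 (n + 1))
  let φ : S →ₗ[A] QuotientPart 𝒮 I (n + 1) := LinearMap.applyₗ v ∘ₗ Φ.toLinearMap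
  have hφmul : ∀ a b, φ (a * b) = Φ a (φ b) := fun a b => by
    simp [φ]
  have hφ : ∀ k, k ≤ n + 1 → ∀ f ∈ 𝒮 k, ∀ hf : l ^ (n + 1 - k) * f ∈ 𝒮 (n + 1),
      φ f = QuotientPart.mk I _ ⟨_, hf⟩ := by
    intro k
    induction k with
    | zero =>
      intro _ f hf hf'
      rw [h, pow_zero, Submodule.mem_one] at hf
      obtain ⟨a, rfl⟩ := hf
      have : φ (algebraMap A S a) = a • v := by simp [φ]
      rw [this, ← map_smul]
      refine congrArg _ (Subtype.ext ?_)
      change a • l ^ (n + 1) = l ^ (n + 1) * algebraMap A S a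
      rw [Algebra.smul_def, mul_comm]
    | succ k ih =>
      intro hk f hf hf'
      rw [succ_eq_mul_of_pow_eq h] at hf
      have hmem : ∀ {y}, y ∈ 𝒮 1 * 𝒮 k → l ^ (n + 1 - (k + 1)) * y ∈ 𝒮 (n + 1) := fun hy =>
        mul_mem_of_pow_eq h (by omega) (pow_mem_of_pow_eq h hl _)
          ((succ_eq_mul_of_pow_eq h k).symm ▸ hy)
      induction hf using Submodule.mul_induction_on' with
      | mem_mul_mem x hx y hy =>
        have hy' : l ^ (n + 1 - k) * y ∈ 𝒮 (n + 1) :=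
          mul_mem_of_pow_eq h (by omega) (pow_mem_of_pow_eq h hl _) hy
        have hy'' : l ^ (n + 1 - (k + 1)) * y ∈ 𝒮 n :=
          mul_mem_of_pow_eq h (by omega) (pow_mem_of_pow_eq h hl _) hy
        rw [hφmul, hΦ ⟨x, hx⟩, ih (by omega) y hy hy', hXmk _ _ ⟨_, hy''⟩]
        · exact congrArg _ (Subtype.ext (mul_left_comm _ _ _))
        · have : n + 1 - k = (n + 1 - (k + 1)) + 1 := by omega
          dsimp only
          rw [this, pow_succ', mul_assoc, sub_self]
          exact I.zero_mem
      | add a ha b hb iha ihb =>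
        rw [map_add, iha (hmem ha), ihb (hmem hb), ← map_add]
        exact congrArg _ (Subtype.ext (mul_add _ _ _).symm)
  refine ⟨Φ, φ, hφmul, (hΦ ⟨l, hl⟩).trans hXl, fun f => ?_⟩
  rw [hφ (n + 1) le_rfl f f.2 (by simp)]
  exact congrArg _ (Subtype.ext (by simp))

end QuotientPart

/-! ### Free modules of a given rank -/

section Free

variable {A : Type*} [CommRing A]

theorem IsFreeOfRank.congr {M N : Type*} [AddCommGroup M] [Module A M] [AddCommGroup N]
    [Module A N] {r : ℕ} (hM : IsFreeOfRank A M r) (e : M ≃ₗ[A] N) : IsFreeOfRank A N r := by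
  obtain ⟨_, hr⟩ := hM
  refine ⟨Module.Free.of_equiv e, ?_⟩
  have := e.lift_rank_eq
  rw [hr, Cardinal.lift_natCast] at this
  exact (Cardinal.lift_eq_nat_iff.mp this.symm)

theorem IsFreeOfRank.exists_basis [Nontrivial A] {M : Type*} [AddCommGroup M] [Module A M] {r : ℕ}
    (hM : IsFreeOfRank A M r) : Nonempty (Module.Basis (Fin r) A M) := by
  obtain ⟨_, hr⟩ := hM
  have := Module.finite_of_rank_eq_nat hr
  exact ⟨Module.finBasisOfFinrankEq A M (Module.finrank_eq_of_rank_eq hr)⟩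

theorem IsFreeOfRank.injective_of_surjective [Nontrivial A] {M N : Type*} [AddCommGroup M]
    [Module A M] [AddCommGroup N] [Module A N] {r : ℕ} (hM : IsFreeOfRank A M r)
    (hN : IsFreeOfRank A N r) (f : M →ₗ[A] N) (hf : Function.Surjective f) :
    Function.Injective f := by
  obtain ⟨b⟩ := hM.exists_basis
  obtain ⟨c⟩ := hN.exists_basis
  have := Module.Finite.of_basis b
  let e : N ≃ₗ[A] M := c.equiv b (Equiv.refl _)
  have : Function.Injective (e.toLinearMap ∘ₗ f) :=
    OrzechProperty.injective_of_surjective_endomorphism _ (e.surjective.comp hf)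
  exact Function.Injective.of_comp (f := e) this

end Free

/-! ### Growth of the degree filtration -/

section Chain

/-- Once the chain pauses it is constant, hence already everything. Until then each step gains a
dimension, starting from one at index `0`, so `W k` has dimension at least `k + 1`. -/
theorem chain_eq_top {κ E : Type*} [Field κ] [AddCommGroup E] [Module κ E] [FiniteDimensional κ E]
    {W : ℕ → Submodule κ E} (hmono : Monotone W) (hbot : W 0 = ⊥ → (⊤ : Submodule κ E) = ⊥)
    (hstab : ∀ k, W (k + 1) ≤ W k → W (k + 2) ≤ W (k + 1)) {n : ℕ} (hn : W n = ⊤) {k : ℕ}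
    (hk : Module.finrank κ E ≤ k + 1) : W k = ⊤ := by
  have key : ∀ k, W k = ⊤ ∨ k + 1 ≤ Module.finrank κ (W k) := by
    intro k
    induction k with
    | zero =>
      by_cases h0 : W 0 = ⊥
      · exact Or.inl (h0.trans (hbot h0).symm)
      · exact Or.inr (Nat.one_le_iff_ne_zero.mpr fun h => h0 (Submodule.finrank_eq_zero.mp h))
    | succ k ih =>
      rcases ih with h | h
      · exact Or.inl (top_le_iff.mp (h ▸ hmono (Nat.le_succ k)))
      by_cases hle : W (k + 1) ≤ W k
      · left
        have hstep : ∀ m, W (k + m + 1) ≤ W (k + m) := by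
          intro m
          induction m with
          | zero => exact hle
          | succ m ih => exact hstab _ ih
        have hconst : ∀ m, W (k + m) ≤ W k := by
          intro m
          induction m with
          | zero => exact le_rfl
          | succ m ih => exact (hstep m).trans ih
        refine top_le_iff.mp ?_
        calc (⊤ : Submodule κ E) = W n := hn.symm
          _ ≤ W (k + n) := hmono (Nat.le_add_left n k)
          _ ≤ W k := hconst n
          _ ≤ W (k + 1) := hmono (Nat.le_succ k)
      · right
        have := Submodule.finrank_lt_finrank_of_lt (lt_of_le_not_ge (hmono k.le_succ) hle)
        rw [Nat.succ_eq_add_one] at this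
        omega
  rcases key k with h | h
  · exact h
  · exact Submodule.eq_top_of_finrank_eq
      (le_antisymm (Submodule.finrank_le _) (hk.trans h))

variable {A S : Type*} [CommRing A] [CommRing S] [Algebra A S] {𝒮 : ℕ → Submodule A S}

open IsLocalRing Submodule in
/-- If `M` is a free quotient of rank `r` of `S`, filtered by the images of the `𝒮 k` and
exhausted by one of them, then already `𝒮 (r - 1)` maps onto `M`. -/
theorem map_eq_top_of_le_succ [IsLocalRing A] (h : ∀ d, 𝒮 d = 𝒮 1 ^ d) {M : Type*}
    [AddCommGroup M] [Module A M] {r : ℕ} (hM : IsFreeOfRank A M r) (Φ : S →ₐ[A] Module.End A M)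
    (φ : S →ₗ[A] M) (hφ : ∀ a b, φ (a * b) = Φ a (φ b)) {l : S} (hl : l ∈ 𝒮 1) (hΦl : Φ l = 1)
    {n : ℕ} (hn : (𝒮 n).map φ = ⊤) {k : ℕ} (hk : r ≤ k + 1) : (𝒮 k).map φ = ⊤ := by
  obtain ⟨b⟩ := hM.exists_basis
  have := Module.Finite.of_basis b
  let m := maximalIdeal A
  let _ : Field (A ⧸ m) := Ideal.Quotient.field m
  let U : ℕ → Submodule A M := fun k => (𝒮 k).map φ
  let N : Submodule A M := m • ⊤
  let W : ℕ → Submodule (A ⧸ m) (M ⧸ N) := fun k => span _ ((U k).map N.mkQ : Set (M ⧸ N))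
  have hres : Function.Surjective (algebraMap A (A ⧸ m)) := Ideal.Quotient.mk_surjective
  have hWU : ∀ k, (W k).restrictScalars A = (U k).map N.mkQ := fun k => by
    rw [restrictScalars_span _ _ hres, span_eq]
  have hW : ∀ a b, W a ≤ W b ↔ U a ≤ U b ⊔ N := fun a b => by
    rw [← restrictScalars_le (S := A), hWU, hWU, map_le_iff_le_comap, comap_map_eq, ker_mkQ]
  have hWtop : ∀ a, W a = ⊤ ↔ U a ⊔ N = ⊤ := fun a => by
    rw [← restrictScalars_eq_top_iff A, hWU, ← (comap_injective_of_surjective N.mkQ_surjective).eq_iff,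
      comap_map_eq, ker_mkQ, comap_top]
  have hmono : Monotone U := monotone_nat_of_le_succ fun k => by
    rintro _ ⟨f, hf, rfl⟩
    refine ⟨l * f, mul_mem_of_pow_eq h (add_comm 1 k) hl hf, ?_⟩
    rw [hφ, hΦl, Module.End.one_apply]
  have hN : ∀ T : Module.End A M, N.map T ≤ N := fun T => by
    rw [show N = m • ⊤ from rfl, map_smul'']
    exact smul_mono le_rfl le_top
  suffices U k ⊔ N = ⊤ by
    refine top_le_iff.mp (le_of_le_smul_of_le_jacobson_bot (I := m) Module.Finite.fg_top
      (maximalIdeal_le_jacobson _) ?_)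
    exact this.ge
  rw [← hWtop]
  refine chain_eq_top (n := n) ?_ ?_ ?_ ?_ ?_
  · exact fun a b hab => (hW a b).mpr ((hmono hab).trans le_sup_left)
  · intro h0
    have h0' : U 0 ≤ N := by
      have h1 := hWU 0
      rw [h0, restrictScalars_bot, eq_comm, ← le_bot_iff, map_le_iff_le_comap, comap_bot, ker_mkQ] at h1
      exact h1
    -- The element `φ 1` generates `M` over `S`, so if it vanishes modulo `N`, everything does.
    have hone : φ 1 ∈ N := h0' ⟨1, by rw [h, pow_zero]; exact one_le.mp le_rfl, rfl⟩
    have : N = ⊤ := by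
      rw [← top_le_iff, ← hn]
      rintro _ ⟨f, -, rfl⟩
      rw [← mul_one f, hφ]
      exact hN _ ⟨_, hone, rfl⟩
    have : Subsingleton (M ⧸ N) := Submodule.Quotient.subsingleton_iff.mpr this
    exact Subsingleton.elim _ _
  · intro k hk
    rw [hW] at hk ⊢
    rintro _ ⟨f, hf, rfl⟩
    rw [SetLike.mem_coe, succ_eq_mul_of_pow_eq h] at hf
    induction hf using Submodule.mul_induction_on' with
    | mem_mul_mem x hx y hy =>
      rw [hφ]
      obtain ⟨_, ⟨f, hf, rfl⟩, c, hc, hac⟩ := mem_sup.mp (hk ⟨y, hy, rfl⟩)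
      rw [← hac, map_add, ← hφ]
      exact add_mem_sup ⟨x * f, mul_mem_of_pow_eq h (add_comm 1 k) hx hf, rfl⟩ (hN _ ⟨_, hc, rfl⟩)
    | add a _ b _ iha ihb => rw [map_add]; exact add_mem iha ihb
  · rw [hWtop, show U n = ⊤ from hn, top_sup_eq]
  · refine le_trans ?_ hk
    have hspan : span (A ⧸ m) (Set.range (N.mkQ ∘ b)) = ⊤ := by
      rw [← restrictScalars_eq_top_iff A, restrictScalars_span _ _ hres, Set.range_comp,
        ← map_span, b.span_eq, Submodule.map_top, range_mkQ]
    calc Module.finrank (A ⧸ m) (M ⧸ N) = (Set.range (N.mkQ ∘ b)).finrank (A ⧸ m) := by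
          rw [Set.finrank, hspan, finrank_top]
      _ ≤ Fintype.card (Fin r) := finrank_range_le_card _
      _ = r := Fintype.card_fin r

end Chain

/-! ### Membership in the saturation -/

section Saturation

open scoped Pointwise

variable {A S : Type*} [CommRing A] [CommRing S] [Algebra A S] {𝒮 : ℕ → Submodule A S}

theorem mem_saturation {J : Ideal S} {f : S} :
    f ∈ saturation 𝒮 J ↔ ∃ m, ∀ g ∈ linearIdeal 𝒮 ^ m, f * g ∈ J := by
  rw [saturation, Submodule.mem_iSup_of_directed]
  · simp [Submodule.mem_colon]
  · refine Monotone.directed_le fun a b hab => ?_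
    intro x hx
    rw [Submodule.mem_colon] at hx ⊢
    exact fun g hg => hx g (Ideal.pow_le_pow_right hab hg)

theorem linearIdeal_pow_le (h : ∀ d, 𝒮 d = 𝒮 1 ^ d) (m : ℕ) :
    linearIdeal 𝒮 ^ m ≤ Ideal.span (𝒮 m : Set S) := by
  have h1 : linearIdeal 𝒮 ^ m = Submodule.span S ((𝒮 1 : Set S) ^ m) :=
    Submodule.span_pow (R := S) (𝒮 1 : Set S) m
  rw [h1, h m]
  exact Submodule.span_mono (Submodule.pow_subset_pow _)

end Saturation

/-! ### Absence of minimal generators -/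

section MinimalGenerators

variable {A S : Type*} [CommRing A] [CommRing S] [Algebra A S] {𝒮 : ℕ → Submodule A S}

/-- A generator of degree `k > i` contributes nothing in degrees up to `i`. The other generators
therefore span the truncation, which contains the given one, making it redundant. -/
theorem not_hasMinimalGenerator [GradedAlgebra 𝒮] {I : Ideal S} {i k : ℕ} (hik : i < k)
    (h : ∀ f ∈ I, f ∈ 𝒮 k → f ∈ truncation 𝒮 I i) : ¬ HasMinimalGenerator 𝒮 I k := by
  rintro ⟨s, ⟨hhom, hspan, hmin⟩, f, hfs, hfk⟩
  have hsub : s \ {f} ⊂ s := ⟨Set.sdiff_subset, fun hs => (hs hfs).2 rfl⟩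
  refine hmin _ hsub ?_
  have hT : (Ideal.span (s \ {f})).IsHomogeneous 𝒮 :=
    Ideal.homogeneous_span 𝒮 _ fun x hx => hhom x hx.1
  have hs : s = insert f (s \ {f}) := by simp [Set.insert_eq_of_mem hfs]
  have hle : truncation 𝒮 I i ≤ Ideal.span (s \ {f}) := by
    refine Ideal.span_le.mpr ?_
    rintro x ⟨hxI, d, hdi, hxd⟩
    rw [← hspan, hs, Ideal.mem_span_insert] at hxI
    obtain ⟨c, t, ht, rfl⟩ := hxI
    have hproj := DirectSum.decompose_of_mem_same 𝒮 hxd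
    rw [DirectSum.decompose_add, DirectSum.add_apply, Submodule.coe_add,
      DirectSum.coe_decompose_mul_of_right_mem_of_not_le 𝒮 hfk (by omega), zero_add] at hproj
    rw [← hproj]
    exact hT d ht
  refine le_antisymm ((Ideal.span_mono Set.sdiff_subset).trans hspan.le) ?_
  rw [← hspan, Ideal.span_le]
  intro x hx
  by_cases hxf : x = f
  · subst hxf
    exact hle (h x (hspan ▸ Ideal.subset_span hx) hfk)
  · exact Ideal.subset_span ⟨hx, hxf⟩

end MinimalGenerators

/-! ### Persistence -/

section Gotzmann

universe u w

variable {A : Type w} {S : Type u} [CommRing A] [CommRing S] [Algebra A S]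
  {𝒮 : ℕ → Submodule A S}

theorem isFreeOfRank_quotientPart {M : Type*} [AddCommGroup M] [Module A M] {r : ℕ}
    (hM : IsFreeOfRank A M r) (φ : S →ₗ[A] M) {K : Ideal S} {k : ℕ}
    (hK : ∀ f ∈ 𝒮 k, f ∈ K ↔ φ f = 0) (hφ : (𝒮 k).map φ = ⊤) :
    IsFreeOfRank A (QuotientPart 𝒮 K k) r := by
  have hsurj : Function.Surjective (φ.domRestrict (𝒮 k)) := fun m => by
    obtain ⟨f, hf, rfl⟩ : m ∈ (𝒮 k).map φ := hφ ▸ Submodule.mem_top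
    exact ⟨⟨f, hf⟩, rfl⟩
  have hker : LinearMap.ker (φ.domRestrict (𝒮 k)) = (degreePart 𝒮 K k).submoduleOf (𝒮 k) := by
    ext ⟨f, hf⟩
    rw [LinearMap.mem_ker, LinearMap.domRestrict_apply, ← hK f hf]
    simp [Submodule.submoduleOf, degreePart]
  exact hM.congr (((Submodule.quotEquivOfEq _ _ hker.symm).trans
    ((φ.domRestrict (𝒮 k)).quotKerEquivOfSurjective hsurj)).symm)

theorem exists_linear_form_of_isFreeOfRank [IsLocalRing A] [Infinite (IsLocalRing.ResidueField A)]
    [GradedAlgebra 𝒮] (h : ∀ d, 𝒮 d = 𝒮 1 ^ d) (hfg : (𝒮 1).FG) {I : Ideal S}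
    (hI : I.IsHomogeneous 𝒮) {r n : ℕ} (hrn : r ≤ n + 1)
    (hfree : IsFreeOfRank A (QuotientPart 𝒮 I (n + 1)) r) :
    ∃ l ∈ 𝒮 1, ∀ f ∈ 𝒮 (n + 1), ∃ g ∈ 𝒮 n, f - l * g ∈ I := by
  classical
  obtain ⟨b⟩ := hfree.exists_basis
  choose c hc using fun t => QuotientPart.mk_surjective I (n + 1) (b t)
  refine exists_linear_form h hfg hI n (Finset.univ.image fun t => (c t : S))
    (Finset.card_image_le.trans (by simpa using hrn)) fun f hf => ?_
  have hmk : QuotientPart.mk I (n + 1) ⟨f, hf⟩ =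
      QuotientPart.mk I (n + 1) (∑ t, b.repr (QuotientPart.mk I (n + 1) ⟨f, hf⟩) t • c t) := by
    rw [map_sum]
    simp only [map_smul, hc, b.sum_repr]
  rw [QuotientPart.mk_eq_mk] at hmk
  refine Submodule.mem_sup.mpr ⟨_, ?_, _, hmk, add_sub_cancel _ _⟩
  rw [Submodule.coe_sum]
  refine Submodule.sum_mem _ fun t _ => Submodule.smul_mem _ _ (Submodule.subset_span ?_)
  simp

/-- Gotzmann's persistence theorem for constant Hilbert polynomials, over a local ring with
infinite residue field. -/
theorem relative_gotzmann [IsLocalRing A] [Infinite (IsLocalRing.ResidueField A)]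
    [GradedAlgebra 𝒮] (h : ∀ d, 𝒮 d = 𝒮 1 ^ d) (hfg : (𝒮 1).FG)
    (hlift : ∀ (C : Type u) [CommRing C] [Algebra A C] (f : 𝒮 1 →ₗ[A] C),
      ∃ F : S →ₐ[A] C, ∀ x : 𝒮 1, F x = f x)
    {r i j : ℕ} (hr : 0 < r) (hri : r ≤ i) (hij : i < j) {I : Ideal S}
    (hI : IsHomogeneousIdeal 𝒮 I) (hIi : IsFreeOfRank A (QuotientPart 𝒮 I i) r)
    (hIj : IsFreeOfRank A (QuotientPart 𝒮 I j) r) {J : Ideal S} (hJ : J = truncation 𝒮 I i) :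
    ((∀ k, i < k → k < j → IsFreeOfRank A (QuotientPart 𝒮 I k) r) ∧
      (∀ k, i < k → k ≤ j → ¬ HasMinimalGenerator 𝒮 I k)) ∧
    (∀ k, i ≤ k → degreePart 𝒮 J k = degreePart 𝒮 (saturation 𝒮 J) k ∧
      IsFreeOfRank A (QuotientPart 𝒮 J k) r ∧
      IsFreeOfRank A (QuotientPart 𝒮 (saturation 𝒮 J) k) r) ∧
    (∀ k, r ≤ k + 1 → IsFreeOfRank A (QuotientPart 𝒮 (saturation 𝒮 J) k) r) := by
  obtain ⟨n, rfl⟩ : ∃ n, i = n + 1 := ⟨i - 1, by omega⟩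
  have hIhom : I.IsHomogeneous 𝒮 := by
    rw [← hI]
    exact Ideal.homogeneous_span 𝒮 _ fun x hx => hx.2
  obtain ⟨l, hl, hsurj⟩ := exists_linear_form_of_isFreeOfRank h hfg hIhom hri hIi
  have hlpow : ∀ {d k k' x}, d + k = k' → x ∈ 𝒮 k → l ^ d * x ∈ 𝒮 k' := fun hd hx =>
    mul_mem_of_pow_eq h hd (pow_mem_of_pow_eq h hl _) hx
  have hinj : ∀ d, n + 1 + d ≤ j → ∀ f ∈ 𝒮 (n + 1), l ^ d * f ∈ I → f ∈ I := by
    -- The injective map `l^(j-n-1)` factors through `l^d`.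
    intro d hd f hf hlf
    have hmul : ∀ x ∈ 𝒮 (n + 1), l ^ (j - (n + 1)) * x ∈ 𝒮 j := fun x hx =>
      hlpow (by omega) hx
    have hs : Function.Surjective (mulQuot I (l ^ (j - (n + 1))) hmul) := by
      intro m
      obtain ⟨⟨y, hy⟩, rfl⟩ := QuotientPart.mk_surjective I _ m
      have hy' : y ∈ 𝒮 (n + 1 + (j - (n + 1))) := by
        rwa [Nat.add_sub_cancel' hij.le]
      obtain ⟨g, hg, hyg⟩ := exists_sub_pow_mul_mem h hsurj n.le_succ _ y hy'
      refine ⟨QuotientPart.mk I _ ⟨g, hg⟩, ?_⟩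
      rw [mulQuot_mk, eq_comm, QuotientPart.mk_eq_mk]
      exact hyg
    have hker := hIi.injective_of_surjective hIj _ hs
    rw [injective_iff_map_eq_zero] at hker
    refine QuotientPart.mk_eq_zero.mp (hker (QuotientPart.mk I _ ⟨f, hf⟩) ?_)
    rw [mulQuot_mk, QuotientPart.mk_eq_zero]
    have : l ^ (j - (n + 1)) * f = l ^ (j - (n + 1) - d) * (l ^ d * f) := by
      rw [← mul_assoc, ← pow_add]
      congr 2
      omega
    change l ^ (j - (n + 1)) * f ∈ I
    rw [this]
    exact I.mul_mem_left _ hlf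
  obtain ⟨Φ, φ, hφmul, hΦl, hφmk⟩ := exists_dehomogenization h hlift hl hsurj
    fun f hf hlf => hinj 1 hij f hf (by rwa [pow_one])
  have hφl : ∀ d f, φ (l ^ d * f) = φ f := fun d f => by
    rw [hφmul, map_pow, hΦl, one_pow, Module.End.one_apply]
  have hφI : ∀ f ∈ 𝒮 (n + 1), φ f = 0 ↔ f ∈ I := fun f hf => by
    rw [hφmk ⟨f, hf⟩, QuotientPart.mk_eq_zero]
  have hJI : J ≤ I := by
    rw [hJ]
    exact Ideal.span_le.mpr fun f hf => hf.1
  have hIJ : ∀ f ∈ 𝒮 (n + 1), f ∈ I → f ∈ J := fun f hf hfI => by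
    rw [hJ]
    exact Ideal.subset_span ⟨hfI, n + 1, le_rfl, hf⟩
  have hsurjJ : ∀ f ∈ 𝒮 (n + 1), ∃ g ∈ 𝒮 n, f - l * g ∈ J := fun f hf => by
    obtain ⟨g, hg, hfg⟩ := hsurj f hf
    exact ⟨g, hg, hIJ _ (sub_mem hf (mul_mem_of_pow_eq h (add_comm 1 n) hl hg)) hfg⟩
  have hφJ : ∀ f ∈ J, φ f = 0 := by
    intro f hf
    rw [hJ] at hf
    refine Submodule.span_induction ?_ (map_zero φ) ?_ ?_ hf
    · rintro x ⟨hxI, d, hd, hxd⟩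
      rw [← hφl (n + 1 - d), hφI _ (hlpow (by omega) hxd)]
      exact I.mul_mem_left _ hxI
    · intro x y _ _ hx hy
      rw [map_add, hx, hy, add_zero]
    · intro a x _ hx
      rw [smul_eq_mul, hφmul, hx, map_zero]
  -- Modulo `J`, `f` is `l^d * g` with `g` of degree `n + 1`, where `φ` detects membership in `I`,
  -- and `I` and `J` agree.
  have hJk : ∀ k, n + 1 ≤ k → ∀ f ∈ 𝒮 k, f ∈ J ↔ φ f = 0 := by
    intro k hk f hf
    refine ⟨hφJ f, fun hf0 => ?_⟩
    obtain ⟨d, rfl⟩ := Nat.exists_eq_add_of_le hk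
    obtain ⟨g, hg, hfg⟩ := exists_sub_pow_mul_mem h hsurjJ n.le_succ d f hf
    have hg0 : φ g = 0 := by
      have := hφJ _ hfg
      rwa [map_sub, hf0, hφl, zero_sub, neg_eq_zero] at this
    have := J.add_mem hfg (J.mul_mem_left (l ^ d) (hIJ g hg ((hφI g hg).mp hg0)))
    rwa [sub_add_cancel] at this
  have hsat : ∀ k, ∀ f ∈ 𝒮 k, f ∈ saturation 𝒮 J ↔ φ f = 0 := by
    intro k f hf
    rw [mem_saturation]
    constructor
    · rintro ⟨m, hm⟩
      rw [← hφl m, mul_comm]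
      exact hφJ _ (hm _ (Ideal.pow_mem_pow (Ideal.subset_span hl) m))
    -- The exponent `n + 1` suffices: it lifts every product into degrees where the kernel of `φ` is
    -- `J`.
    · intro hf0
      refine ⟨n + 1, fun g hg => ?_⟩
      refine Submodule.span_induction (p := fun g _ => f * g ∈ J) ?_ ?_ ?_ ?_
        (linearIdeal_pow_le h _ hg)
      · intro x hx
        rw [mul_comm, hJk (n + 1 + k) (by omega) _ (mul_mem_of_pow_eq h rfl hx hf), hφmul, hf0,
          map_zero]
      · rw [mul_zero]
        exact J.zero_mem
      · intro x y _ _ hx hy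
        rw [mul_add]
        exact J.add_mem hx hy
      · intro a x _ hx
        rw [smul_eq_mul, mul_left_comm]
        exact J.mul_mem_left a hx
  have htop : ∀ k, n + 1 ≤ k → (𝒮 k).map φ = ⊤ := by
    intro k hk
    refine eq_top_iff.mpr fun m _ => ?_
    obtain ⟨f, rfl⟩ := QuotientPart.mk_surjective I _ m
    refine ⟨l ^ (k - (n + 1)) * f, hlpow (by omega) f.2, ?_⟩
    rw [hφl, hφmk]
  have hIk : ∀ k, n + 1 ≤ k → k ≤ j → ∀ f ∈ 𝒮 k, f ∈ I → f ∈ J := by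
    intro k hk hkj f hf hfI
    obtain ⟨d, rfl⟩ := Nat.exists_eq_add_of_le hk
    obtain ⟨g, hg, hfg⟩ := exists_sub_pow_mul_mem h hsurjJ n.le_succ d f hf
    have hlg : l ^ d * g ∈ I := by
      have := I.sub_mem hfI (hJI hfg)
      rwa [sub_sub_cancel] at this
    have := J.add_mem hfg (J.mul_mem_left (l ^ d) (hIJ g hg (hinj d hkj g hg hlg)))
    rwa [sub_add_cancel] at this
  have hsatfree : ∀ k, r ≤ k + 1 → IsFreeOfRank A (QuotientPart 𝒮 (saturation 𝒮 J) k) r :=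
    fun k hk => isFreeOfRank_quotientPart hIi φ (hsat k)
      (map_eq_top_of_le_succ h hIi Φ φ hφmul hl hΦl (htop (n + 1) le_rfl) hk)
  refine ⟨⟨fun k hk hkj => ?_, fun k hk hkj => ?_⟩, fun k hk => ⟨?_, ?_, ?_⟩, hsatfree⟩
  · refine isFreeOfRank_quotientPart hIi φ (fun f hf => ?_) (htop k hk.le)
    rw [← hJk k hk.le f hf]
    exact ⟨hIk k hk.le hkj.le f hf, fun hfJ => hJI hfJ⟩
  · refine not_hasMinimalGenerator hk fun f hf hfk => ?_
    rw [← hJ]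
    exact hIk k hk.le hkj f hfk hf
  · ext f
    refine and_congr_left fun hf => ?_
    exact (hJk k hk f hf).trans (hsat k f hf).symm
  · exact isFreeOfRank_quotientPart hIi φ (hJk k hk) (htop k hk)
  · exact hsatfree k (by omega)

end Gotzmann

end RelGotzmann

open RelGotzmann in
theorem proposition2 {𝕜 A V : Type*} [Field 𝕜] [IsAlgClosed 𝕜]
    [CommRing A] [Algebra 𝕜 A] [IsLocalRing A] [FiniteDimensional 𝕜 A]
    (hA : IsGorenstein 𝕜 A)
    [AddCommGroup V] [Module 𝕜 V] [FiniteDimensional 𝕜 V]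
    (r i j : ℕ) (hr : 0 < r) (hri : r ≤ i) (hij : i < j)
    (I : Ideal (RelSym 𝕜 A V)) (hI : IsHomogeneousIdeal (grading 𝕜 A V) I)
    (hIi : IsFreeOfRank A (QuotientPart (grading 𝕜 A V) I i) r)
    (hIj : IsFreeOfRank A (QuotientPart (grading 𝕜 A V) I j) r)
    (J : Ideal (RelSym 𝕜 A V)) (hJ : J = truncation (grading 𝕜 A V) I i) :
    ((∀ k, i < k → k < j → IsFreeOfRank A (QuotientPart (grading 𝕜 A V) I k) r) ∧
      (∀ k, i < k → k ≤ j → ¬ HasMinimalGenerator (grading 𝕜 A V) I k)) ∧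
    (∀ k, i ≤ k →
      degreePart (grading 𝕜 A V) J k =
        degreePart (grading 𝕜 A V) (saturation (grading 𝕜 A V) J) k ∧
      IsFreeOfRank A (QuotientPart (grading 𝕜 A V) J k) r ∧
      IsFreeOfRank A
        (QuotientPart (grading 𝕜 A V) (saturation (grading 𝕜 A V) J) k) r) ∧
    (∀ k, r ≤ k + 1 →
      IsFreeOfRank A
        (QuotientPart (grading 𝕜 A V) (saturation (grading 𝕜 A V) J) k) r) := by
  obtain ⟨_⟩ := nonempty_gradedAlgebra_grading (𝕜 := 𝕜) (A := A) (V := V)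
  have : Infinite 𝕜 := inferInstance
  have : Infinite (IsLocalRing.ResidueField A) :=
    Infinite.of_injective _ (algebraMap 𝕜 (IsLocalRing.ResidueField A)).injective
  exact relative_gotzmann grading_eq_pow grading_one_fg (fun _ _ _ => exists_algHom_extending)
    hr hri hij hI hIi hIj hJ
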